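/- Let $\mathcal A$ be a (not necessarily unital) complex C*-algebra and let $\mathcal B$ be a C*-subalgebra of $\mathcal A$ (a norm-closed $*$-subalgebra). For $A\in\mathcal A$ put $L(A)=\inf\{\|A-B\| : B\in\mathcal B\}$. A seminorm $M$ on $\mathcal A$ is called *Leibniz* if $M(AC)\le M(A)\|C\|+\|A\|M(C)$ for all $A,C\in\mathcal A$. If $\mathcal A$ is unital, $M$ is called *strongly-Leibniz* if it is Leibniz, $M(1_{\mathcal A})=0$, and $M(A^{-1})\le\|A^{-1}\|^2M(A)$ for every invertible $A\in\mathcal A$. (1) Suppose that $\mathcal B$ contains a bounded approximate identity for $\mathcal A$, that is, there is a norm-bounded net $(E_\lambda)$ in $\mathcal B$ with $E_\lambda A\to A$ and $AE_\lambda\to A$ in norm for every $A\in\mathcal A$. Then $L$ is the largest Leibniz seminorm on $\mathcal A$ that takes the value $0$ on $\mathcal B$ and is dominated by the C*-norm: $L$ is itself a Leibniz seminorm with $L(B)=0$ for all $B\in\mathcal B$ and $L(A)\le\|A\|$ for all $A\in\mathcal A$, and every Leibniz seminorm $M$ on $\mathcal A$ with these two properties satisfies $M(A)\le L(A)$ for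 all $A\in\mathcal A$. (2) If $\mathcal A$ is unital and $1_{\mathcal A}\in\mathcal B$, then $L$ is, in the same sense, the largest strongly-Leibniz seminorm on $\mathcal A$ that takes the value $0$ on $\mathcal B$ and is dominated by the C*-norm. -/

import Mathlib

section QuotientSeminorm

variable {A : Type*} [NonUnitalCStarAlgebra A]

/-- `a ↦ inf {‖a - b‖ : b ∈ B}`: the quotient norm of `A / B`, pulled back to a seminorm on `A`. -/
noncomputable def quotientSeminorm (B : NonUnitalStarSubalgebra ℂ A) : Seminorm ℂ A :=
  Seminorm.ofSMulLE (fun a => ⨅ b : B, ‖a - (b : A)‖)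
    (le_antisymm
      ((ciInf_le ⟨0, by rintro _ ⟨b, rfl⟩; exact norm_nonneg _⟩ (0 : B)).trans (by simp))
      (Real.iInf_nonneg fun _ => norm_nonneg _))
    (fun x y => by
      refine le_ciInf_add_ciInf fun b c => ?_
      refine (ciInf_le ⟨0, by rintro _ ⟨b, rfl⟩; exact norm_nonneg _⟩ (b + c)).trans ?_
      have h : x + y - ((b + c : B) : A) = (x - b) + (y - c) := by push_cast; abel
      rw [h]
      exact norm_add_le _ _)
    (fun r x => by
      rw [Real.mul_iInf_of_nonneg (norm_nonneg r)]
      refine le_ciInf fun b => ?_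
      refine (ciInf_le ⟨0, by rintro _ ⟨b, rfl⟩; exact norm_nonneg _⟩ (r • b)).trans ?_
      have h : r • x - ((r • b : B) : A) = r • (x - b) := by push_cast; rw [smul_sub]
      rw [h, norm_smul])

/-- `B` contains a bounded approximate identity for `A`. The approximate identity is given as a
filter; for a net it is the filter of tails. -/
def ContainsBoundedApproximateIdentity (B : NonUnitalStarSubalgebra ℂ A) : Prop :=
  ∃ l : Filter A, l.IsApproximateUnit ∧ ∃ K : ℝ, ∀ᶠ e in l, e ∈ B ∧ ‖e‖ ≤ K

/-- The Leibniz inequality for a seminorm on a C⋆-algebra. -/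
def IsLeibniz (M : Seminorm ℂ A) : Prop :=
  ∀ a c : A, M (a * c) ≤ M a * ‖c‖ + ‖a‖ * M c

end QuotientSeminorm

/-- Strongly-Leibniz seminorms on a unital C⋆-algebra. -/
structure IsStronglyLeibniz {A : Type*} [CStarAlgebra A] (M : Seminorm ℂ A) : Prop where
  leibniz : IsLeibniz M
  map_one : M 1 = 0
  map_inv : ∀ u : Aˣ, M (↑u⁻¹ : A) ≤ ‖(↑u⁻¹ : A)‖ ^ 2 * M (u : A)

/-! Maximality is the triangle inequality `M a ≤ M (a - b) + M b`. The substance is that the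
distance to `B` is Leibniz, and it is so because, in a representation chosen for the given element,
it is half the norm of a commutator, and commutators are derivations.

Hahn–Banach gives a contractive `ψ` that vanishes on `B` and takes the distance as its value at `a`.
By `exists_positiveLinearMap_norm_sq_le` there is a contractive positive `φ` with `|ψ x|² ≤ φ (x⋆
x)`, so `ψ` is represented by a vector `η` of the GNS space of `φ`, orthogonal to the image of `B`.
The reflection `U` in the closure of that image commutes with `B` and negates `η`. Pairing `η` with
`[U, π a]`, applied to vectors from an approximate identity in `B`, recovers twice the distance.
Conversely, `‖[U, π x]‖ ≤ 2 ‖x - b‖` for all `x` and all `b ∈ B`. -/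

open Filter Topology
open scoped ComplexOrder InnerProductSpace ComplexStarModule

/-! ### Dominating a functional by a positive one -/

section Domination

variable {A : Type*} [NonUnitalCStarAlgebra A] [PartialOrder A] [StarOrderedRing A]

/-- The rotation identity: a suitable combination `x` of `c` and `d` has `|x|² ≤ |c|² + |d|²` and
absorbs the values of a linear functional at `c` and `d`. -/
lemma exists_star_mul_self_le_add (ψ : A →ₗ[ℂ] ℂ) (c d : A) :
    ∃ x : A, star x * x ≤ star c * c + star d * d ∧ ‖ψ x‖ ^ 2 = ‖ψ c‖ ^ 2 + ‖ψ d‖ ^ 2 := by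
  by_cases h0 : ‖ψ c‖ ^ 2 + ‖ψ d‖ ^ 2 = 0
  · refine ⟨0, ?_, by simp [h0]⟩
    simpa using add_nonneg (star_mul_self_nonneg c) (star_mul_self_nonneg d)
  set s : ℝ := ‖ψ c‖ ^ 2 + ‖ψ d‖ ^ 2 with hs
  have hs0 : 0 ≤ s := by positivity
  set r : ℝ := √s
  have hr : (r : ℂ) ^ 2 = s := by exact_mod_cast Real.sq_sqrt hs0
  have hr0 : (r : ℂ) ≠ 0 := by
    intro h
    rw [h] at hr
    exact h0 (by exact_mod_cast (by simpa using hr.symm : (s : ℂ) = 0))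
  set p : ℂ := ψ c / r
  set q : ℂ := ψ d / r
  have hn (z : ℂ) : star z * z = ((‖z‖ ^ 2 : ℝ) : ℂ) := by
    simpa using Complex.conj_mul' z
  have hsum : ψ c * star (ψ c) + ψ d * star (ψ d) = (r : ℂ) ^ 2 := by
    rw [hr, mul_comm, hn, mul_comm, hn, hs]; push_cast; rfl
  have hstar_r : star (r : ℂ) = r := Complex.conj_ofReal r
  have hpq : p * star p + q * star q = 1 := by
    simp only [p, q, star_div₀, hstar_r]
    field_simp
    exact hsum
  refine ⟨star p • c + star q • d, ?_, ?_⟩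
  -- `(p, q)` is a unit vector, so `(c, d) ↦ (p̄ c + q̄ d, q c - p d)` is a unitary rotation and
  -- preserves the sum of squares. The second square is then dropped.
  · have key : star c * c + star d * d =
        star (star p • c + star q • d) * (star p • c + star q • d) +
          star (q • c - p • d) * (q • c - p • d) := by
      have e : star (star p • c + star q • d) * (star p • c + star q • d) +
          star (q • c - p • d) * (q • c - p • d) =
          (p * star p + q * star q) • (star c * c) + (p * star p + q * star q) • (star d * d) := by
        simp only [star_add, star_sub, star_smul, star_star, add_mul, mul_add, sub_mul, mul_sub,
          smul_mul_assoc, mul_smul_comm]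
        module
      rw [e, hpq, one_smul, one_smul]
    rw [key]
    exact le_add_of_nonneg_right (star_mul_self_nonneg _)
  · have e : ψ (star p • c + star q • d) = r := by
      simp only [map_add, map_smul, smul_eq_mul, p, q, star_div₀, hstar_r]
      field_simp
      rw [← hsum]; ring
    rw [e, Complex.norm_real, Real.norm_eq_abs, sq_abs, Real.sq_sqrt hs0]

/-- A real functional on a C⋆-algebra, taking nonnegative values on positive elements, extends
(from the self-adjoint part) to a positive linear functional. -/
lemma exists_positiveLinearMap_of_real (g : A →ₗ[ℝ] ℝ) (hg : ∀ x, 0 ≤ x → 0 ≤ g x) :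
    ∃ φ : A →ₚ[ℂ] ℂ, ∀ x, IsSelfAdjoint x → φ x = g x := by
  let f : A →ₗ[ℂ] ℂ :=
    { toFun a := (g (ℜ a) : ℂ) + Complex.I * (g (ℑ a) : ℂ)
      map_add' x y := by simp; ring
      map_smul' z x := by
        apply Complex.ext <;> simp [realPart_smul, imaginaryPart_smul] }
  have hf (x : A) (hx : IsSelfAdjoint x) : f x = g x := by
    simp [f, hx.coe_realPart, hx.imaginaryPart]
  refine ⟨.mk₀ f fun x hx ↦ ?_, hf⟩
  rw [hf x (.of_nonneg hx)]
  exact_mod_cast hg x hx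

/-- A contractive functional on a C⋆-algebra is dominated by a contractive positive functional. -/
theorem exists_positiveLinearMap_norm_sq_le (ψ : A →ₗ[ℂ] ℂ) (hψ : ∀ a, ‖ψ a‖ ≤ ‖a‖) :
    ∃ φ : A →ₚ[ℂ] ℂ, ∀ a,
      ‖ψ a‖ ^ 2 ≤ (φ (star a * a)).re ∧ (φ (star a * a)).re ≤ ‖a‖ ^ 2 := by
  -- The infimum `N` of `F x` over `S` is sublinear, and any real functional below `N` has both
  -- required bounds.
  let S := {p : A × A // star p.2 * p.2 ≤ p.1}
  let F (x : A) (p : S) : ℝ := ‖x + p.1.1‖ - ‖ψ p.1.2‖ ^ 2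
  have : Nonempty S := ⟨⟨(0, 0), by simp⟩⟩
  have hF (x : A) (p : S) : -‖x‖ ≤ F x p := by
    have h1 : ‖ψ p.1.2‖ ^ 2 ≤ ‖p.1.1‖ := calc
      ‖ψ p.1.2‖ ^ 2 ≤ ‖p.1.2‖ ^ 2 := by gcongr; exact hψ _
      _ = ‖star p.1.2 * p.1.2‖ := by rw [CStarRing.norm_star_mul_self, sq]
      _ ≤ ‖p.1.1‖ := CStarAlgebra.norm_le_norm_of_nonneg_of_le (star_mul_self_nonneg _) p.2
    have h2 : ‖p.1.1‖ ≤ ‖x + p.1.1‖ + ‖x‖ := by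
      simpa using norm_sub_le (x + p.1.1) x
    simp only [F]; linarith
  have hbdd (x : A) : BddBelow (Set.range (F x)) := ⟨-‖x‖, by rintro _ ⟨p, rfl⟩; exact hF x p⟩
  let N (x : A) : ℝ := ⨅ p : S, F x p
  have N_le (c : ℝ) (hc : 0 < c) (x : A) : N (c • x) ≤ c * N x := by
    rw [Real.mul_iInf_of_nonneg hc.le]
    refine le_ciInf fun p ↦ ?_
    -- The second component enters quadratically, hence is scaled by `√c`.
    have hsq : √c * √c = c := Real.mul_self_sqrt hc.le
    refine (ciInf_le (hbdd _) ⟨(c • p.1.1, √c • p.1.2), ?_⟩).trans_eq ?_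
    · simp only [star_smul, star_trivial, smul_mul_assoc, mul_smul_comm, smul_smul, hsq]
      exact smul_le_smul_of_nonneg_left p.2 hc.le
    · have e : ψ (√c • p.1.2) = (√c : ℂ) * ψ p.1.2 := by
        rw [← Complex.coe_smul, map_smul, smul_eq_mul]
      simp only [F, ← smul_add, norm_smul, e, norm_mul, mul_pow, Complex.norm_real,
        Real.norm_eq_abs, sq_abs, Real.sq_sqrt hc.le, abs_of_pos hc]
      ring
  have N_hom (c : ℝ) (hc : 0 < c) (x : A) : N (c • x) = c * N x := by
    refine (N_le c hc x).antisymm ?_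
    have := N_le c⁻¹ (inv_pos.2 hc) (c • x)
    rw [smul_smul, inv_mul_cancel₀ hc.ne', one_smul] at this
    rwa [← le_inv_mul_iff₀ hc]
  have N_add (x y : A) : N (x + y) ≤ N x + N y := by
    refine le_ciInf_add_ciInf fun p q ↦ ?_
    obtain ⟨z, hz, hz'⟩ := exists_star_mul_self_le_add ψ p.1.2 q.1.2
    refine (ciInf_le (hbdd _) ⟨(p.1.1 + q.1.1, z), hz.trans (add_le_add p.2 q.2)⟩).trans ?_
    have e : x + y + (p.1.1 + q.1.1) = (x + p.1.1) + (y + q.1.1) := by abel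
    have := norm_add_le (x + p.1.1) (y + q.1.1)
    simp only [F, hz', e]
    linarith
  have N_zero : 0 ≤ N 0 := le_ciInf fun p ↦ by simpa using hF 0 p
  -- Hahn–Banach, extending the zero functional on the zero subspace.
  obtain ⟨g, -, hg⟩ := exists_extension_of_le_sublinear (⟨⊥, 0⟩ : A →ₗ.[ℝ] ℝ) N N_hom N_add
    (by rintro ⟨x, hx⟩; obtain rfl := (Submodule.mem_bot ℝ).1 hx; simpa using! N_zero)
  have hg_norm (x : A) : g x ≤ ‖x‖ :=
    (hg x).trans ((ciInf_le (hbdd x) ⟨(0, 0), by simp⟩).trans (by simp [F]))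
  have hg_le (h a : A) (ha : star a * a ≤ h) : ‖ψ a‖ ^ 2 ≤ g h := by
    -- At `-h` the pair `(h, a)` cancels the norm term of `F`.
    have := (hg (-h)).trans (ciInf_le (hbdd (-h)) ⟨(h, a), ha⟩)
    simp only [F, neg_add_cancel, norm_zero, map_neg] at this
    linarith
  obtain ⟨φ, hφ⟩ := exists_positiveLinearMap_of_real g fun x hx ↦ by
    simpa using hg_le x 0 (by simpa using hx)
  refine ⟨φ, fun a ↦ ?_⟩
  rw [hφ _ (.star_mul_self a), Complex.ofReal_re]
  exact ⟨hg_le _ a le_rfl, (hg_norm _).trans_eq (by rw [CStarRing.norm_star_mul_self, sq])⟩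

end Domination

/-! ### The distance to the subalgebra -/

section QuotientSeminorm

variable {A : Type*} [NonUnitalCStarAlgebra A] (B : NonUnitalStarSubalgebra ℂ A)

lemma quotientSeminorm_apply (a : A) : quotientSeminorm B a = ⨅ b : B, ‖a - (b : A)‖ := rfl

lemma le_quotientSeminorm_iff {a : A} {r : ℝ} :
    r ≤ quotientSeminorm B a ↔ ∀ b ∈ B, r ≤ ‖a - b‖ := by
  rw [quotientSeminorm_apply, le_ciInf_iff ⟨0, by rintro _ ⟨b, rfl⟩; exact norm_nonneg _⟩]
  simp

lemma quotientSeminorm_le_norm_sub (a : A) {b : A} (hb : b ∈ B) :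
    quotientSeminorm B a ≤ ‖a - b‖ :=
  (le_quotientSeminorm_iff B).1 le_rfl b hb

lemma quotientSeminorm_le_norm (a : A) : quotientSeminorm B a ≤ ‖a‖ := by
  simpa using quotientSeminorm_le_norm_sub B a B.zero_mem

lemma quotientSeminorm_eq_zero_of_mem {b : A} (hb : b ∈ B) : quotientSeminorm B b = 0 :=
  le_antisymm (by simpa using quotientSeminorm_le_norm_sub B b hb) (apply_nonneg _ _)

/-- The quotient seminorm dominates every seminorm that vanishes on the subalgebra and is
dominated by the norm. -/
lemma le_quotientSeminorm {M : Seminorm ℂ A} (hB : ∀ b ∈ B, M b = 0) (hM : ∀ a, M a ≤ ‖a‖) :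
    M ≤ quotientSeminorm B := by
  intro a
  refine (le_quotientSeminorm_iff B).2 fun b hb ↦ ?_
  calc M a = M ((a - b) + b) := by rw [sub_add_cancel]
    _ ≤ M (a - b) + M b := map_add_le_add M _ _
    _ ≤ ‖a - b‖ := by simpa [hB b hb] using hM (a - b)

/-- Hahn–Banach: the distance to the subalgebra is attained by a contractive functional that
vanishes on the subalgebra. -/
lemma exists_functional_eq_quotientSeminorm (a : A) :
    ∃ ψ : A →ₗ[ℂ] ℂ, (∀ x, ‖ψ x‖ ≤ ‖x‖) ∧ (∀ b ∈ B, ψ b = 0) ∧ ψ a = quotientSeminorm B a := by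
  let V : Submodule ℂ A := B.toNonUnitalSubalgebra.toSubmodule
  obtain ⟨g, hg, hga⟩ := exists_dual_vector'' ℂ (V.mkQ a)
  refine ⟨g.toLinearMap ∘ₗ V.mkQ, fun x ↦ ?_, fun b hb ↦ ?_, ?_⟩
  · calc ‖g (V.mkQ x)‖ ≤ 1 * ‖V.mkQ x‖ := g.le_of_opNorm_le hg _
      _ ≤ ‖x‖ := by rw [one_mul]; exact Submodule.Quotient.norm_mk_le V x
  · have : V.mkQ b = 0 := (Submodule.Quotient.mk_eq_zero V).2 hb
    simp [this]
  · have e : ‖V.mkQ a‖ = quotientSeminorm B a := by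
      refine (QuotientAddGroup.norm_mk (S := V.toAddSubgroup) a).trans ?_
      rw [Metric.infDist_eq_iInf, quotientSeminorm_apply]
      simp only [dist_eq_norm]
      rfl
    rw [← e]
    exact hga

/-- A closed ⋆-subalgebra containing a bounded approximate identity contains a contractive one. -/
lemma exists_mem_norm_le_one_norm_mul_sub_lt (hB : IsClosed (B : Set A))
    (h : ContainsBoundedApproximateIdentity B) (a : A) {ε : ℝ} (hε : 0 < ε) :
    ∃ u ∈ B, ‖u‖ ≤ 1 ∧ ‖a * u - a‖ < ε := by
  obtain ⟨l, hl, K, hK⟩ := h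
  have := hl.neBot
  obtain ⟨e, he, heB, -⟩ := ((Metric.tendsto_nhds.1 (hl.tendsto_mul_left a) (ε / 3)
    (by positivity)).and hK).exists
  rw [dist_eq_norm] at he
  -- Being closed, `B` is a C⋆-algebra and has its own contractive approximate unit. The given one
  -- only supplies `e ∈ B` with `a * e` near `a`; then `e * u` near `e` forces `a * u` near `a`.
  have : IsClosed (B : Set A) := hB
  let _ := CStarAlgebra.spectralOrder B
  let _ := CStarAlgebra.spectralOrderedRing B
  have hu := CStarAlgebra.increasingApproximateUnit B
  have := hu.neBot
  have hpos : 0 < ε / 3 / (‖a‖ + 1) := by positivity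
  obtain ⟨u, hu1, hu2⟩ := ((Metric.tendsto_nhds.1 (hu.tendsto_mul_left ⟨e, heB⟩) _ hpos).and
    hu.eventually_norm).exists
  have hu1' : ‖e * (u : A) - e‖ < ε / 3 / (‖a‖ + 1) := by rwa [dist_eq_norm] at hu1
  have hu2' : ‖(u : A)‖ ≤ 1 := hu2
  refine ⟨u, u.2, hu2', ?_⟩
  rw [lt_div_iff₀ (by positivity)] at hu1'
  have e1 : a * (u : A) - a = -((a * e - a) * u) + a * (e * u - e) + (a * e - a) := by
    simp only [sub_mul, mul_sub, mul_assoc]; abel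
  have h1 : ‖(a * e - a) * (u : A)‖ ≤ ‖a * e - a‖ :=
    (norm_mul_le _ _).trans (mul_le_of_le_one_right (norm_nonneg _) hu2')
  have h2 : ‖a * (e * (u : A) - e)‖ ≤ ‖e * (u : A) - e‖ * (‖a‖ + 1) := by
    refine (norm_mul_le _ _).trans ?_
    nlinarith [norm_nonneg (e * (u : A) - e)]
  rw [e1]
  refine (norm_add₃_le).trans_lt ?_
  rw [norm_neg]
  linarith

end QuotientSeminorm

/-! ### Reflections and GNS vectors -/

/-- The reflection in a closed subspace that is invariant under `T` and `T⋆` commutes with `T`. -/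
lemma Submodule.reflection_comm_of_invariant {H : Type*} [NormedAddCommGroup H]
    [InnerProductSpace ℂ H] [CompleteSpace H] (V : Submodule ℂ H) [V.HasOrthogonalProjection]
    (T : H →L[ℂ] H) (hT : ∀ x ∈ V, T x ∈ V) (hT' : ∀ x ∈ V, star T x ∈ V) (x : H) :
    V.reflection (T x) = T (V.reflection x) := by
  have horth (y : H) (hy : y ∈ Vᗮ) : T y ∈ Vᗮ := by
    rw [Submodule.mem_orthogonal] at hy ⊢
    intro u hu
    rw [← ContinuousLinearMap.adjoint_inner_left]
    exact hy _ (hT' u hu)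
  obtain ⟨y, hy, z, hz, rfl⟩ := V.exists_add_mem_mem_orthogonal x
  simp only [map_add, V.reflection_mem_subspace_eq_self hy,
    V.reflection_mem_subspace_eq_self (hT y hy),
    V.reflection_mem_subspace_orthogonalComplement_eq_neg hz,
    V.reflection_mem_subspace_orthogonalComplement_eq_neg (horth z hz), map_neg]

/-- A functional bounded by the seminorm of a positive functional is represented by a vector of the
GNS space. -/
lemma exists_gns_vector {A : Type*} [NonUnitalCStarAlgebra A] [PartialOrder A] [StarOrderedRing A]
    (φ : A →ₚ[ℂ] ℂ) (ψ : A →ₗ[ℂ] ℂ) (h : ∀ a, ‖ψ a‖ ^ 2 ≤ (φ (star a * a)).re) :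
    ∃ η : φ.GNS, ‖η‖ ≤ 1 ∧ ∀ a, ⟪η, (φ.toPreGNS a : φ.GNS)⟫_ℂ = ψ a := by
  let f : φ.PreGNS →L[ℂ] ℂ := (ψ ∘ₗ φ.ofPreGNS.toLinearMap).mkContinuous 1 fun x ↦ by
    rw [one_mul, φ.preGNS_norm_def]
    exact Real.le_sqrt_of_sq_le (h _)
  have hf (x : φ.PreGNS) : ‖f x‖ ≤ ‖x‖ := by
    simpa using f.le_of_opNorm_le (LinearMap.mkContinuous_norm_le _ zero_le_one _) x
  let F : φ.GNS →L[ℂ] ℂ := f.fromCompletion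
  have hF (x : φ.PreGNS) : F x = f x := by simp [F]
  refine ⟨(InnerProductSpace.toDual ℂ φ.GNS).symm F, ?_, fun a ↦ ?_⟩
  · rw [LinearIsometryEquiv.norm_map]
    refine F.opNorm_le_bound zero_le_one fun x ↦ ?_
    rw [one_mul]
    induction x using UniformSpace.Completion.induction_on with
    | hp => exact isClosed_le (by fun_prop) (by fun_prop)
    | ih x => rw [hF, UniformSpace.Completion.norm_coe]; exact hf x
  · rw [InnerProductSpace.toDual_symm_apply, hF]
    rfl

/-! ### The distance as a commutator norm -/

section Commutator

variable {A : Type*} [NonUnitalCStarAlgebra A] (B : NonUnitalStarSubalgebra ℂ A)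

/-- In a representation where the contraction `U` commutes with `B`, half the norm of the commutator
with `U` is bounded by the distance to `B`. -/
lemma norm_commutator_le_two_mul_quotientSeminorm {H : Type*} [NormedAddCommGroup H]
    [InnerProductSpace ℂ H] [CompleteSpace H] (π : A →⋆ₙₐ[ℂ] (H →L[ℂ] H)) {U : H →L[ℂ] H}
    (hU : ‖U‖ ≤ 1) (hcomm : ∀ b ∈ B, U * π b = π b * U) (a : A) :
    ‖U * π a - π a * U‖ ≤ 2 * quotientSeminorm B a := by
  rw [← div_le_iff₀' two_pos, le_quotientSeminorm_iff]
  intro b hb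
  rw [div_le_iff₀' two_pos]
  have e : U * π a - π a * U = U * π (a - b) - π (a - b) * U := by
    rw [map_sub, mul_sub, sub_mul, hcomm b hb]; abel
  have hπ := NonUnitalStarAlgHom.norm_apply_le π (a - b)
  have h1 : ‖U * π (a - b)‖ ≤ ‖a - b‖ :=
    (norm_mul_le _ _).trans ((mul_le_of_le_one_left (norm_nonneg _) hU).trans hπ)
  have h2 : ‖π (a - b) * U‖ ≤ ‖a - b‖ :=
    (norm_mul_le _ _).trans ((mul_le_of_le_one_right (norm_nonneg _) hU).trans hπ)
  rw [e]
  linarith [norm_sub_le (U * π (a - b)) (π (a - b) * U)]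

/-- The distance to `B` is attained as half the norm of a commutator with a contraction that
commutes with `B`, in some representation. -/
theorem exists_representation_two_mul_quotientSeminorm_le.{u} {A : Type u}
    [NonUnitalCStarAlgebra A] (B : NonUnitalStarSubalgebra ℂ A) (hB : IsClosed (B : Set A))
    (h : ContainsBoundedApproximateIdentity B) (a : A) :
    ∃ (H : Type u) (_ : NormedAddCommGroup H) (_ : InnerProductSpace ℂ H) (_ : CompleteSpace H)
      (π : A →⋆ₙₐ[ℂ] (H →L[ℂ] H)) (U : H →L[ℂ] H), ‖U‖ ≤ 1 ∧
      (∀ b ∈ B, U * π b = π b * U) ∧ 2 * quotientSeminorm B a ≤ ‖U * π a - π a * U‖ := by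
  let _ := CStarAlgebra.spectralOrder A
  let _ := CStarAlgebra.spectralOrderedRing A
  obtain ⟨ψ, hψ, hψB, hψa⟩ := exists_functional_eq_quotientSeminorm B a
  obtain ⟨φ, hφ⟩ := exists_positiveLinearMap_norm_sq_le ψ hψ
  obtain ⟨η, hη, hηψ⟩ := exists_gns_vector φ ψ fun a ↦ (hφ a).1
  let π := φ.gnsNonUnitalStarAlgHom
  let ι : A →ₗ[ℂ] φ.GNS :=
    (UniformSpace.Completion.toComplL (𝕜 := ℂ) (E := φ.PreGNS)).toLinearMap ∘ₗ
      φ.toPreGNS.toLinearMap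
  have hι (c x : A) : π c (ι x) = ι (c * x) := φ.gnsNonUnitalStarAlgHom_apply_coe
  have hι_norm (x : A) : ‖ι x‖ ≤ ‖x‖ := by
    refine (UniformSpace.Completion.norm_coe _).trans_le ?_
    rw [φ.preGNS_norm_def]
    exact Real.sqrt_le_iff.2 ⟨norm_nonneg _, (hφ x).2⟩
  let V : Submodule ℂ φ.GNS :=
    (B.toNonUnitalSubalgebra.toSubmodule.map ι).topologicalClosure
  have : CompleteSpace V := (Submodule.isClosed_topologicalClosure _).completeSpace_coe
  have hV (b : A) (hb : b ∈ B) : ι b ∈ V :=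
    Submodule.le_topologicalClosure _ (Submodule.mem_map_of_mem hb)
  have hinv (b : A) (hb : b ∈ B) (x : φ.GNS) (hx : x ∈ V) : π b x ∈ V := by
    refine map_mem_closure (π b).continuous hx ?_
    rintro _ ⟨c, hc, rfl⟩
    rw [hι]
    exact ⟨b * c, B.mul_mem hb hc, rfl⟩
  have hη_orth : η ∈ Vᗮ := by
    rw [Submodule.orthogonal_closure, Submodule.mem_orthogonal']
    rintro _ ⟨b, hb, rfl⟩
    exact (hηψ b).trans (hψB b hb)
  let U : φ.GNS →L[ℂ] φ.GNS := V.reflection.toContinuousLinearEquiv.toContinuousLinearMap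
  have hU_apply (x : φ.GNS) : U x = V.reflection x := rfl
  refine ⟨φ.GNS, inferInstance, inferInstance, inferInstance, π, U, ?_, fun b hb ↦ ?_, ?_⟩
  · exact U.opNorm_le_bound zero_le_one fun x ↦ by rw [hU_apply, LinearIsometryEquiv.norm_map]; simp
  · ext x : 1
    refine V.reflection_comm_of_invariant (π b) (hinv b hb) ?_ x
    rw [← map_star]
    exact hinv _ (star_mem hb)
  · refine le_of_forall_pos_le_add fun ε hε ↦ ?_
    obtain ⟨u, huB, hu1, hu⟩ := exists_mem_norm_le_one_norm_mul_sub_lt B hB h a (half_pos hε)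
    set T := U * π a - π a * U with hT
    have hηU (x : φ.GNS) : ⟪η, U x⟫_ℂ = -⟪η, x⟫_ℂ := by
      have e := V.reflection.inner_map_map η x
      rw [V.reflection_mem_subspace_orthogonalComplement_eq_neg hη_orth, inner_neg_left] at e
      rw [hU_apply, ← e, neg_neg]
    -- `U` fixes `ι u ∈ V` and negates `η`, so the two terms of the commutator add up instead of
    -- cancelling.
    have hTu : ⟪η, T (ι u)⟫_ℂ = -(2 * ψ (a * u)) := by
      have e : T (ι u) = U (ι (a * u)) - ι (a * u) := by
        rw [← hι, hT, sub_apply, mul_apply_eq_comp,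
          mul_apply_eq_comp, hU_apply (ι u),
          V.reflection_mem_subspace_eq_self (hV u huB)]
      have e' : ⟪η, ι (a * u)⟫_ℂ = ψ (a * u) := hηψ (a * u)
      rw [e, inner_sub_right, hηU, e']
      ring
    have h1 : 2 * ‖ψ (a * u)‖ ≤ ‖T‖ := calc
      2 * ‖ψ (a * u)‖ = ‖⟪η, T (ι u)⟫_ℂ‖ := by rw [hTu]; simp
      _ ≤ ‖η‖ * ‖T (ι u)‖ := norm_inner_le_norm _ _
      _ ≤ 1 * (‖T‖ * 1) := by
        gcongr
        exact (T.le_opNorm _).trans (by gcongr; exact (hι_norm u).trans hu1)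
      _ = ‖T‖ := by ring
    have h2 : quotientSeminorm B a = ‖ψ a‖ := by
      rw [hψa, Complex.norm_real, Real.norm_of_nonneg (apply_nonneg _ _)]
    have h3 : ‖ψ a‖ ≤ ‖ψ (a * u)‖ + ‖a * u - a‖ := by
      have := norm_sub_le (ψ (a * u)) (ψ (a * u - a))
      rw [← map_sub, sub_sub_cancel] at this
      linarith [hψ (a * u - a)]
    linarith

theorem isLeibniz_quotientSeminorm (hB : IsClosed (B : Set A))
    (h : ContainsBoundedApproximateIdentity B) : IsLeibniz (quotientSeminorm B) := by
  intro a c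
  -- The representation is adapted to `a * c` only; for `a` and `c` the upper bound `key` suffices.
  obtain ⟨H, _, _, _, π, U, hU, hcomm, hle⟩ :=
    exists_representation_two_mul_quotientSeminorm_le B hB h (a * c)
  have key := norm_commutator_le_two_mul_quotientSeminorm B π hU hcomm
  have e : U * π (a * c) - π (a * c) * U =
      (U * π a - π a * U) * π c + π a * (U * π c - π c * U) := by
    rw [map_mul]; noncomm_ring
  have h1 : ‖(U * π a - π a * U) * π c‖ ≤ 2 * quotientSeminorm B a * ‖c‖ :=
    (norm_mul_le _ _).trans (mul_le_mul (key a) (NonUnitalStarAlgHom.norm_apply_le π c)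
      (norm_nonneg _) (mul_nonneg zero_le_two (apply_nonneg _ _)))
  have h2 : ‖π a * (U * π c - π c * U)‖ ≤ ‖a‖ * (2 * quotientSeminorm B c) :=
    (norm_mul_le _ _).trans (mul_le_mul (NonUnitalStarAlgHom.norm_apply_le π a) (key c)
      (norm_nonneg _) (norm_nonneg _))
  rw [e] at hle
  linarith [norm_add_le ((U * π a - π a * U) * π c) (π a * (U * π c - π c * U))]

end Commutator

/-! ### Inverses in the unital case -/

section Unital

variable {A : Type*} [CStarAlgebra A] (B : NonUnitalStarSubalgebra ℂ A)

lemma containsBoundedApproximateIdentity_of_one_mem (h1 : (1 : A) ∈ B) :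
    ContainsBoundedApproximateIdentity B :=
  ⟨pure 1, .pure_one A, ‖(1 : A)‖, by simpa using h1⟩

theorem isStronglyLeibniz_quotientSeminorm (hB : IsClosed (B : Set A)) (h1 : (1 : A) ∈ B) :
    IsStronglyLeibniz (quotientSeminorm B) where
  leibniz := isLeibniz_quotientSeminorm B hB (containsBoundedApproximateIdentity_of_one_mem B h1)
  map_one := quotientSeminorm_eq_zero_of_mem B h1
  map_inv u := by
    obtain ⟨H, _, _, _, π, U, hU, hcomm, hle⟩ :=
      exists_representation_two_mul_quotientSeminorm_le B hB
        (containsBoundedApproximateIdentity_of_one_mem B h1) (↑u⁻¹ : A)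
    have key := norm_commutator_le_two_mul_quotientSeminorm B π hU hcomm (u : A)
    set v : A := ↑u⁻¹
    -- `π` need not be unital, but `π 1` commutes with `U` because `1 ∈ B`. This is enough for `[U,
    -- π v] = -π v [U, π u] π v`.
    have hvu : π v * π u = π 1 := by rw [← map_mul, u.inv_mul]
    have huv : π u * π v = π 1 := by rw [← map_mul, u.mul_inv]
    have h1v : π 1 * π v = π v := by rw [← map_mul, one_mul]
    have hv1 : π v * π 1 = π v := by rw [← map_mul, mul_one]
    have e : U * π v - π v * U = -(π v * (U * π u - π u * U) * π v) := by
      have e1 : π v * (U * π u - π u * U) * π v =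
          π v * (U * (π u * π v)) - π v * π u * U * π v := by noncomm_ring
      rw [e1, huv, hvu, ← hcomm 1 h1, mul_assoc U, h1v, hcomm 1 h1, ← mul_assoc, hv1]
      abel
    have hπ := NonUnitalStarAlgHom.norm_apply_le π v
    have h2 : ‖π v * (U * π u - π u * U) * π v‖ ≤ ‖v‖ * (2 * quotientSeminorm B (u : A)) * ‖v‖ := by
      refine norm_mul₃_le.trans ?_
      have := apply_nonneg (quotientSeminorm B) (u : A)
      gcongr
    rw [e, norm_neg] at hle
    linarith

end Unital

theorem corollary3p5 :
    (∀ (A : Type*) [NonUnitalCStarAlgebra A] (B : NonUnitalStarSubalgebra ℂ A),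
      IsClosed (B : Set A) → ContainsBoundedApproximateIdentity B →
        IsGreatest
          {M : Seminorm ℂ A | IsLeibniz M ∧ (∀ b ∈ B, M b = 0) ∧ ∀ a : A, M a ≤ ‖a‖}
          (quotientSeminorm B)) ∧
    (∀ (A : Type*) [CStarAlgebra A] (B : NonUnitalStarSubalgebra ℂ A),
      IsClosed (B : Set A) → (1 : A) ∈ B →
        IsGreatest
          {M : Seminorm ℂ A | IsStronglyLeibniz M ∧ (∀ b ∈ B, M b = 0) ∧ ∀ a : A, M a ≤ ‖a‖}
          (quotientSeminorm B)) :=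
  ⟨fun _ _ B hB h ↦
    ⟨⟨isLeibniz_quotientSeminorm B hB h, fun _ ↦ quotientSeminorm_eq_zero_of_mem B,
      quotientSeminorm_le_norm B⟩, fun _ hM ↦ le_quotientSeminorm B hM.2.1 hM.2.2⟩,
  fun _ _ B hB h1 ↦
    ⟨⟨isStronglyLeibniz_quotientSeminorm B hB h1, fun _ ↦ quotientSeminorm_eq_zero_of_mem B,
      quotientSeminorm_le_norm B⟩, fun _ hM ↦ le_quotientSeminorm B hM.2.1 hM.2.2⟩⟩
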